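/- **Setting.** Let $Y=\{f=0\}$ be a germ at the origin of a complex hypersurface of $\mathbb C^{n+1}$ (coordinates $(x,y)=(x_1,\dots,x_n,y)$), where $f\in\mathbb C\{x_1,\dots,x_n,y\}$ is irreducible and $f(0)=0$. Assume that $Y$ is quasi-ordinary with respect to $(x,y)\mapsto x$: the discriminant, i.e. the image of $\{f=\partial f/\partial y=0\}$ under $(x,y)\mapsto x$, is the germ at $0$ of $\{\prod_{v\in S}x_v=0\}$ for some set $S$ of indices. Let $N_0=1,N_1,\dots,N_m$ be ramified monomials (monomials in $x_1,\dots,x_n$ with non-negative rational exponents), each properly dividing the next one (that is, the exponents are non-decreasing and $N_{i-1}\ne N_i$), such that $Y$ is parametrized near the origin by $x\mapsto(x,\varphi(x))$ with $$\varphi=N_1g_1+\dots+N_mg_m,$$ where $g_i$ is a unit of the ring $\mathbb C\{x_1^{1/c_{i1}},\dots,x_n^{1/c_{in}}\}$ and $c_{iv}$ is the least common denominator of the exponents of $x_v$ in $N_0,\dots,N_i$. (Here $\varphi$ is multivalued: $Y$ is the set of all $(x,y)$ near $0$ such that $y$ is the value of $\varphi$ for some choice of the roots $x_v^{1/c_{mv}}$.)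 The monomial $N_i$, $1\le i\le m$, is called very special if $\{N_i=0\}\ne\{N_{i-1}=0\}$. Let $M_1,\dots,M_g$ be the very special monomials among $N_1,\dots,N_m$, in this order, and put $M_0=1$. For $1\le k\le g$ let $x_{k1},\dots,x_{km_k}$ be the variables that occur in $M_k$ but not in $M_{k-1}$, and let $a_{kkj}>0$ be the exponent of $x_{kj}$ in $M_k$. Let $(\xi:\eta)=(\xi_1:\dots:\xi_n:\eta)$ be the homogeneous coordinates of $\mathbb P_n$ dual to $(x,y)$, and write $\xi_{kj}$ for the coordinate dual to $x_{kj}$. Let $\Gamma$ be the smallest closed analytic subset of $\mathbb P^*\mathbb C^{n+1}=\mathbb C^{n+1}\times\mathbb P_n$ (as a germ along the fibre over $0$) that contains the graph of the map $\left(\frac{\partial f}{\partial x_1}:\dots:\frac{\partial f}{\partial x_n}:\frac{\partial f}{\partial y}\right)$ on the regular part of $Y$, and let $\Lambda\subset\mathbb P_n$ be the fibre of $\Gamma$ over $0$ (the set of limits of tangents of $Y$). **Theorem.** Let $1\le k\le g$ and $I\subset\{1,\dots,m_k\}$. Assume that one of the following three conditions holds: 1. $\sum_{j\in I}a_{kkj}>1$;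 2. $k=1$, $\sum_{j\in I}a_{11j}=1$ and $\sum_{j=1}^{m_1}a_{11j}>1$; 3. $k\ge2$ and $\sum_{j\in I}a_{kkj}=1$. Then $\Lambda\subset\left\{\prod_{j\in I}\xi_{kj}=0\right\}$. -/

import Mathlib

open Filter Topology
open scoped NNRat

/-! ### Analytic subsets and limits of tangents -/

/-- `ℂⁿ⁺¹` with coordinates `(x, y) = (x₁, …, xₙ, y)`. The same space, with coordinates
`(ξ, η) = (ξ₁, …, ξₙ, η)`, serves as the space of covectors. -/
abbrev Cspace (n : ℕ) : Type := (Fin n → ℂ) × ℂ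

/-- The projective space `ℙₙ` of covectors, with homogeneous coordinates `(ξ₁ : ⋯ : ξₙ : η)`. -/
abbrev Pspace (n : ℕ) : Type := Projectivization ℂ (Cspace n)

/-- `S` is a (closed) analytic subset of the open set `Ω`: near every point of `Ω` it is the set of
common zeros of finitely many holomorphic functions. -/
def IsAnalyticSubset {E : Type*} [NormedAddCommGroup E] [NormedSpace ℂ E] (Ω S : Set E) : Prop :=
  S ⊆ Ω ∧ ∀ p ∈ Ω, ∃ (r : ℕ) (h : Fin r → E → ℂ),
    (∀ i, AnalyticAt ℂ (h i) p) ∧ ∀ᶠ q in 𝓝 p, (q ∈ S ↔ ∀ i, h i q = 0)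

/-- The cone over a subset `A` of `ℂⁿ⁺¹ × ℙₙ`: its inverse image under the holomorphic submersion
`ℂⁿ⁺¹ × (ℂⁿ⁺¹ ∖ 0) → ℂⁿ⁺¹ × ℙₙ`. -/
def coneOver {n : ℕ} (A : Set (Cspace n × Pspace n)) : Set (Cspace n × Cspace n) :=
  {z | ∃ h : z.2 ≠ 0, (z.1, Projectivization.mk ℂ z.2 h) ∈ A}

/-- `A` is a closed analytic subset of the projective cotangent bundle `ℙ*U = U × ℙₙ`, `U` open in
`ℂⁿ⁺¹`. Analyticity is tested on the inverse image under the submersion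
`U × (ℂⁿ⁺¹ ∖ 0) → U × ℙₙ`, which is equivalent to testing it in the affine charts. -/
def IsAnalyticSubsetOver {n : ℕ} (U : Set (Cspace n)) (A : Set (Cspace n × Pspace n)) : Prop :=
  A ⊆ U ×ˢ Set.univ ∧ IsAnalyticSubset (U ×ˢ {0}ᶜ) (coneOver A)

/-- The vector `(∂f/∂x₁, …, ∂f/∂xₙ, ∂f/∂y)` at `q`. -/
noncomputable def gradientVec {n : ℕ} (f : Cspace n → ℂ) (q : Cspace n) : Cspace n :=
  (fun v => fderiv ℂ f q (Pi.single v 1, 0), fderiv ℂ f q (0, 1))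

/-- The graph `Γ₀` of the map `(∂f/∂x₁ : ⋯ : ∂f/∂xₙ : ∂f/∂y)` on the regular part of the
hypersurface `f = 0`. -/
def gaussGraph {n : ℕ} (f : Cspace n → ℂ) : Set (Cspace n × Pspace n) :=
  {z | f z.1 = 0 ∧ ∃ h : gradientVec f z.1 ≠ 0, z.2 = Projectivization.mk ℂ (gradientVec f z.1) h}

/-- The smallest closed analytic subset `Γ` of `ℙ*U` that contains the part of `Γ₀` over `U`. -/
def conormalOver {n : ℕ} (f : Cspace n → ℂ) (U : Set (Cspace n)) : Set (Cspace n × Pspace n) :=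
  ⋂₀ {A | IsAnalyticSubsetOver U A ∧ gaussGraph f ∩ (U ×ˢ Set.univ) ⊆ A}

/-- The set `Λ = Γ ∩ π⁻¹(0)` of limits of tangents of the germ at the origin of the hypersurface
`f = 0`. Here `Γ` is the smallest closed analytic germ along `π⁻¹(0)` that contains `Γ₀`: since
`conormalOver f V` lies in `conormalOver f U` for `V ⊆ U`, one intersects over all open
neighbourhoods `U` of the origin. -/
def limitsOfTangents {n : ℕ} (f : Cspace n → ℂ) : Set (Pspace n) :=
  {p | ∀ U : Set (Cspace n), IsOpen U → (0 : Cspace n) ∈ U → ((0 : Cspace n), p) ∈ conormalOver f U}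

/-! ### Irreducible quasi-ordinary hypersurface germs -/

/-- The germ of `f` at the origin is an irreducible element of `ℂ{x₁, …, xₙ, y}`
(the units of this ring are the germs that do not vanish at the origin). -/
def IsIrreducibleGerm {n : ℕ} (f : Cspace n → ℂ) : Prop :=
  AnalyticAt ℂ f 0 ∧ f 0 = 0 ∧
    ∀ g h : Cspace n → ℂ, AnalyticAt ℂ g 0 → AnalyticAt ℂ h 0 → f =ᶠ[𝓝 0] g * h →
      g 0 ≠ 0 ∨ h 0 ≠ 0

/-- Quasi-ordinary with respect to `(x, y) ↦ x`: the germ at the origin of the discriminant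
`Δ`, the image of the apparent contour `f = ∂f/∂y = 0`, is `{∏_{v ∈ S} x_v = 0}` for some set `S`
of variables. -/
def IsQuasiOrdinary {n : ℕ} (f : Cspace n → ℂ) : Prop :=
  ∃ S : Finset (Fin n), ∀ᶠ δ : ℝ in 𝓝[>] 0, ∀ᶠ x : Fin n → ℂ in 𝓝 0,
    (∃ y : ℂ, ‖y‖ < δ ∧ f (x, y) = 0 ∧ fderiv ℂ f (x, y) (0, 1) = 0) ↔ ∏ v ∈ S, x v = 0

/-! ### Ramified monomials and parametrizations

A ramified monomial `∏ x_v ^ (a v)` is given by its exponent vector `a : Fin n → ℚ≥0`. -/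

/-- The common denominator of the exponents of `x_v` in the monomials `N 0, …, N i`. It is the
denominator of `N i v` alone as soon as `N (j-1)` divides `N j` in the ring of convergent series
with the denominators of `N j`, for each `j ≤ i`. It is `1` if `x_v` does not occur. -/
def ramIndex {n m : ℕ} (N : Fin (m + 1) → Fin n → ℚ≥0) (i : Fin (m + 1)) (v : Fin n) : ℕ :=
  (Finset.Iic i).lcm fun j => (N j v).den

/-- The function `φ = N₁ g₁ + ⋯ + N_m g_m` of the variables `t_v = x_v ^ (1 / d_v)`,
`d_v = ramIndex N (Fin.last m) v`. The factor `g_i` is the series `G` evaluated at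
`x_v ^ (1 / ramIndex N i v)`, a power of `t_v`. (`N i v * d_v` is an integer.) -/
noncomputable def ramifiedSum {n m : ℕ} (N : Fin (m + 1) → Fin n → ℚ≥0)
    (G : Fin m → (Fin n → ℂ) → ℂ) (t : Fin n → ℂ) : ℂ :=
  ∑ i : Fin m, (∏ v, t v ^ (N i.succ v * (ramIndex N (Fin.last m) v : ℚ≥0)).num) *
    G i (fun v => t v ^ (ramIndex N (Fin.last m) v / ramIndex N i.succ v))

/-- `N 0 = 1, N 1, …, N m` are ramified monomials, each properly dividing the next one, and the
germ at the origin of `f = 0` is parametrized by `x ↦ (x, φ(x))`, where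
`φ = N₁ g₁ + ⋯ + N_m g_m` with units `g_i` of the ring of convergent series in the
`x_v ^ (1 / ramIndex N i v)`. -/
def HasSpecialMonomials {n m : ℕ} (f : Cspace n → ℂ) (N : Fin (m + 1) → Fin n → ℚ≥0) : Prop :=
  N 0 = 0 ∧ StrictMono N ∧
  ∃ G : Fin m → (Fin n → ℂ) → ℂ,
    (∀ i, AnalyticAt ℂ (G i) 0 ∧ G i 0 ≠ 0) ∧
    ∀ᶠ q : Cspace n in 𝓝 0, f q = 0 ↔
      ∃ t : Fin n → ℂ, (∀ v, t v ^ ramIndex N (Fin.last m) v = q.1 v) ∧ q.2 = ramifiedSum N G t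

/-- The zero set of a ramified monomial. -/
def monomialZeroSet {n : ℕ} (a : Fin n → ℚ≥0) : Set (Fin n → ℂ) :=
  {x | ∃ v, a v ≠ 0 ∧ x v = 0}

open Classical in
/-- The `i` for which `N (i+1)` is very special: `{N (i+1) = 0} ≠ {N i = 0}`. -/
noncomputable def verySpecialIndices {n m : ℕ} (N : Fin (m + 1) → Fin n → ℚ≥0) : Finset (Fin m) :=
  Finset.univ.filter fun i => monomialZeroSet (N i.succ) ≠ monomialZeroSet (N i.castSucc)

/-- The number `g` of very special monomials. -/
noncomputable def numVerySpecial {n m : ℕ} (N : Fin (m + 1) → Fin n → ℚ≥0) : ℕ :=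
  (verySpecialIndices N).card

/-- The very special monomials `M₁, …, M_g` in increasing order, preceded by `M₀ = 1`
(the value `1` for indices larger than `g` is not used). -/
noncomputable def verySpecialMonomial {n m : ℕ} (N : Fin (m + 1) → Fin n → ℚ≥0) :
    ℕ → Fin n → ℚ≥0
  | 0 => 0
  | k + 1 =>
    if h : k < (verySpecialIndices N).card then
      N ((verySpecialIndices N).orderEmbOfFin rfl ⟨k, h⟩).succ
    else 0

/-- The variables `x_{k1}, …, x_{k m_k}`: those that occur in `M_k` but not in `M_{k-1}`. -/
noncomputable def newVariables {n m : ℕ} (N : Fin (m + 1) → Fin n → ℚ≥0) (k : ℕ) : Finset (Fin n) :=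
  Finset.univ.filter fun v => verySpecialMonomial N k v ≠ 0 ∧ verySpecialMonomial N (k - 1) v = 0

/-!
Write `x_v = t_v ^ d_v`, with `d_v` the common denominator of all exponents of `x_v`, so that the
hypersurface is the image of `t ↦ (t ^ d, φ(t))` with `φ` analytic. Let `(ξ, η)` be the gradient of
`f` at such a point; then `ξ_v = - η ∂φ/∂x_v`. If `x_v` is new in `M_k`, the special monomials
before `M_k` do not involve `x_v`, so the corresponding terms of `φ` are analytic in `x_v` itself,
and `∂φ/∂x_v = α_v + M_k β_v / x_v` with `α_v`, `β_v` analytic in `t` and `α_v(0) = 0`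
(`exists_logDeriv_ramifiedSum`). Hence `ξ_v + η α_v = - η M_k β_v / x_v`.

Raise this to a power `e_v` proportional to the exponent `a_v` of `x_v` in `M_k`, and multiply over
`v ∈ I`. On the right one gets `η ^ E`, `E = ∑ e_v`, times an analytic function and the monomial
`M_k ^ E / ∏ x_v ^ e_v`. The exponent of `x_w`, `w ∈ I`, in this monomial is proportional to
`a_w (∑ a_v - 1) ≥ 0`, and the exponents of the other variables of `M_k` are positive. Each of the
three conditions of the theorem makes some exponent positive (`exists_balanced_powers`). Therefore
`∏ (ξ_v + η α_v) ^ e_v = η ^ E ψ` with `ψ(0) = 0` (`gradientVec_equation`).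

This equation is homogeneous in `(ξ, η)` but has coefficients in `t`. The product of its conjugates
under `t_v ↦ ζ_v t_v`, `ζ_v ^ d_v = 1`, has coefficients analytic in `x`
(`exists_analytic_norm`): they are invariant, hence equal to their averages, and the average of an
analytic function is an analytic function of `t ^ d`, because averaging an absolutely convergent
sum of monomials keeps just the monomials in the `t_v ^ d_v` (`AnalyticAt.exists_average_eq`). The
norm defines an analytic subset of the projective cotangent bundle that contains the Gauss graph,
hence the conormal variety, and its fibre over the origin is given by a power of
`∏ ξ_v ^ e_v = 0` (`limitsOfTangents_subset_of_equation`).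
-/

/-! ### Convergent sums of monomials -/

theorem norm_prod_pow_le {n : ℕ} {ρ : ℝ} {t : Fin n → ℂ} (β : Fin n → ℕ) (ht : ‖t‖ ≤ ρ) :
    ‖∏ v, t v ^ β v‖ ≤ ρ ^ ∑ v, β v := by
  rw [norm_prod, ← Finset.prod_pow_eq_pow_sum]
  refine Finset.prod_le_prod (fun _ _ => norm_nonneg _) fun v _ => ?_
  rw [norm_pow]
  exact pow_le_pow_left₀ (norm_nonneg _) ((norm_le_pi_norm t v).trans ht) _

/-- A monomial of degree `k` is the diagonal of a `k`-linear form of norm at most one. -/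
theorem exists_multilinear_monomial {n : ℕ} (β : Fin n → ℕ) (k : ℕ) (hk : ∑ v, β v = k) :
    ∃ M : ContinuousMultilinearMap ℂ (fun _ : Fin k => Fin n → ℂ) ℂ,
      ‖M‖ ≤ 1 ∧ ∀ x, (M fun _ => x) = ∏ v, x v ^ β v := by
  subst hk
  refine ⟨(ContinuousMultilinearMap.mkPiAlgebra ℂ (Fin (∑ v, β v)) ℂ).compContinuousLinearMap
    (fun j => ContinuousLinearMap.proj (finSigmaFinEquiv.symm j).1), ?_, fun x => ?_⟩
  · refine ContinuousMultilinearMap.opNorm_le_bound zero_le_one fun m => ?_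
    rw [one_mul, ContinuousMultilinearMap.compContinuousLinearMap_apply,
      ContinuousMultilinearMap.mkPiAlgebra_apply, norm_prod]
    exact Finset.prod_le_prod (fun _ _ => norm_nonneg _) fun j _ => norm_le_pi_norm (m j) _
  · rw [ContinuousMultilinearMap.compContinuousLinearMap_apply,
      ContinuousMultilinearMap.mkPiAlgebra_apply]
    simp only [ContinuousLinearMap.proj_apply]
    rw [Equiv.prod_comp finSigmaFinEquiv.symm
      (fun p : (i : Fin n) × Fin (β i) => x p.1), Fintype.prod_sigma]
    simp

/-- The sum of a family of monomials that converges absolutely on some polydisc is analytic. -/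
theorem analyticAt_tsum_monomial {ι : Type*} {n : ℕ} (b : ι → ℂ) (β : ι → Fin n → ℕ)
    {ρ : NNReal} (hρ : 0 < ρ) (hs : Summable fun i => ‖b i‖ * (ρ : ℝ) ^ ∑ v, β i v) :
    AnalyticAt ℂ (fun x : Fin n → ℂ => ∑' i, b i * ∏ v, x v ^ β i v) 0 := by
  let deg : ι → ℕ := fun i => ∑ v, β i v
  choose M hM1 hM using fun (k : ℕ) (i : {i // deg i = k}) =>
    exists_multilinear_monomial (β i) k i.2
  have hfib : ∀ k, Summable fun i : {i // deg i = k} => ‖b i‖ * (ρ : ℝ) ^ k := fun k => by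
    refine (hs.subtype {i | deg i = k}).congr fun i => ?_
    have : ∑ v, β i.1 v = k := i.2
    simp only [Function.comp_apply, this]
  have hb : ∀ k, Summable fun i : {i // deg i = k} => ‖b i‖ := fun k =>
    (summable_mul_right_iff (pow_pos (NNReal.coe_pos.2 hρ) k).ne').1 (hfib k)
  have hle : ∀ k (i : {i // deg i = k}), ‖b i • M k i‖ ≤ ‖b i‖ := fun k i => by
    rw [norm_smul]
    exact mul_le_of_le_one_right (norm_nonneg _) (hM1 k i)
  have hsum : ∀ k, Summable fun i : {i // deg i = k} => b i • M k i := fun k =>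
    Summable.of_norm_bounded (hb k) (hle k)
  let p : FormalMultilinearSeries ℂ (Fin n → ℂ) ℂ := fun k => ∑' i : {i // deg i = k}, b i • M k i
  refine HasFPowerSeriesAt.analyticAt (p := p) ⟨ρ, ?_, by exact_mod_cast hρ, fun {y} hy => ?_⟩
  · refine p.le_radius_of_bound (∑' i, ‖b i‖ * (ρ : ℝ) ^ ∑ v, β i v) fun k => ?_
    calc ‖p k‖ * (ρ : ℝ) ^ k ≤ (∑' i : {i // deg i = k}, ‖b i‖) * (ρ : ℝ) ^ k := by
          gcongr
          exact tsum_of_norm_bounded (hb k).hasSum (hle k)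
      _ = ∑' i : {i // deg i = k}, ‖b i‖ * (ρ : ℝ) ^ ∑ v, β i v := by
          rw [← tsum_mul_right]
          refine tsum_congr fun i => ?_
          have : ∑ v, β i v = k := i.2
          rw [this]
      _ ≤ _ := hs.tsum_subtype_le _ {i | deg i = k} (fun i => by positivity)
  · have hy' : ‖y‖ < ρ := by
      simpa [Metric.mem_eball, edist_zero_right, enorm_eq_nnnorm, ← NNReal.coe_lt_coe] using hy
    have h1 : Summable fun i => b i * ∏ v, y v ^ β i v := by
      refine Summable.of_norm_bounded hs fun i => ?_
      rw [norm_mul]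
      exact mul_le_mul_of_nonneg_left (norm_prod_pow_le _ hy'.le) (norm_nonneg _)
    have h2 := (Equiv.sigmaFiberEquiv deg).hasSum_iff.2 h1.hasSum
    rw [zero_add]
    refine h2.sigma fun k => ?_
    have h3 := ContinuousMultilinearMap.hasSum_eval (hsum k).hasSum (fun _ => y)
    refine h3.congr_fun ?_
    intro i
    simp [hM, Equiv.sigmaFiberEquiv]

/-- An analytic function is near the origin the sum of an absolutely convergent family of
monomials. The family is indexed by words in the variables, so that a monomial may occur several
times. -/
theorem AnalyticAt.exists_hasSum_monomial {n : ℕ} {f : (Fin n → ℂ) → ℂ} (hf : AnalyticAt ℂ f 0) :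
    ∃ (c : (Σ k : ℕ, Fin k → Fin n) → ℂ) (γ : (Σ k : ℕ, Fin k → Fin n) → Fin n → ℕ) (ρ : NNReal),
      0 < ρ ∧ ρ ≤ 1 ∧ (Summable fun i => ‖c i‖ * (ρ : ℝ) ^ ∑ v, γ i v) ∧
      ∀ t : Fin n → ℂ, ‖t‖ < ρ → HasSum (fun i => c i * ∏ v, t v ^ γ i v) (f t) := by
  obtain ⟨p, r, hp⟩ := hf
  obtain ⟨r', hr'0, hr'⟩ := ENNReal.lt_iff_exists_nnreal_btwn.1 hp.r_pos
  have hr'0 : 0 < r' := by exact_mod_cast hr'0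
  -- there are `n ^ k` words of length `k`, hence the radius is divided by `n + 1`
  let ρ : NNReal := min 1 (r' / (n + 1))
  have hρ0 : 0 < ρ := lt_min one_pos (by positivity)
  have hρr : ρ * (n + 1) ≤ r' := by
    have : ρ ≤ r' / (n + 1) := min_le_right _ _
    rwa [le_div_iff₀ (by positivity)] at this
  have hρr' : ρ ≤ r' := le_trans (le_mul_of_one_le_right (zero_le) (by simp)) hρr
  let c : (Σ k : ℕ, Fin k → Fin n) → ℂ := fun i => p i.1 fun j => Pi.single (i.2 j) 1
  let γ : (Σ k : ℕ, Fin k → Fin n) → Fin n → ℕ := fun i v => (Finset.univ.filter (i.2 · = v)).card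
  have hγ : ∀ i, ∑ v, γ i v = i.1 := fun i => by
    have := Finset.card_eq_sum_card_fiberwise (f := i.2) (s := Finset.univ) (t := Finset.univ)
      (fun _ _ => by simp)
    simpa using this.symm
  have hc : ∀ i, ‖c i‖ ≤ ‖p i.1‖ := fun i => by
    have h1 : ∀ v : Fin n, ‖(Pi.single v 1 : Fin n → ℂ)‖ = 1 := fun v => by
      rw [Pi.norm_single, norm_one]
    simpa only [h1, Finset.prod_const_one, mul_one] using
      (p i.1).le_opNorm fun j => (Pi.single (i.2 j) 1 : Fin n → ℂ)
  have hS : Summable fun i => ‖c i‖ * (ρ : ℝ) ^ ∑ v, γ i v := by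
    rw [summable_sigma_of_nonneg (fun i => by positivity)]
    refine ⟨fun k => (hasSum_fintype _).summable, ?_⟩
    have h1 := p.summable_norm_mul_pow (hr'.trans_le hp.r_le)
    refine Summable.of_nonneg_of_le (fun k => tsum_nonneg fun _ => by positivity) (fun k => ?_) h1
    rw [tsum_fintype]
    calc ∑ w : Fin k → Fin n, ‖c ⟨k, w⟩‖ * (ρ : ℝ) ^ ∑ v, γ ⟨k, w⟩ v
        ≤ ∑ w : Fin k → Fin n, ‖p k‖ * (ρ : ℝ) ^ k := by
          refine Finset.sum_le_sum fun w _ => ?_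
          rw [hγ]
          exact mul_le_mul_of_nonneg_right (hc ⟨k, w⟩) (by positivity)
      _ = ‖p k‖ * ((ρ : ℝ) * n) ^ k := by
          simp [mul_pow]; ring
      _ ≤ ‖p k‖ * (r' : ℝ) ^ k := by
          have : (ρ : ℝ) * (n + 1) ≤ r' := by exact_mod_cast hρr
          gcongr
          nlinarith [ρ.coe_nonneg]
  refine ⟨c, γ, ρ, hρ0, min_le_left _ _, hS, fun t ht => ?_⟩
  have h1 : Summable fun i => c i * ∏ v, t v ^ γ i v := by
    refine Summable.of_norm_bounded hS fun i => ?_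
    rw [norm_mul]
    exact mul_le_mul_of_nonneg_left (norm_prod_pow_le _ ht.le) (norm_nonneg _)
  have h2 : HasSum (fun k => (p k) fun _ => t) (∑' i, c i * ∏ v, t v ^ γ i v) := by
    refine h1.hasSum.sigma fun k => ?_
    have hexp : ((p k) fun _ => t) = ∑ w : Fin k → Fin n, c ⟨k, w⟩ * ∏ v, t v ^ γ ⟨k, w⟩ v := by
      have ht' : t = ∑ v, t v • (Pi.single v 1 : Fin n → ℂ) := by
        ext u
        simp [Finset.sum_apply, Pi.single_apply]
      conv_lhs => rw [ht']
      rw [ContinuousMultilinearMap.map_sum]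
      refine Finset.sum_congr rfl fun w _ => ?_
      rw [ContinuousMultilinearMap.map_smul_univ, smul_eq_mul, mul_comm]
      congr 1
      rw [← Finset.prod_fiberwise Finset.univ w]
      refine Finset.prod_congr rfl fun v _ => ?_
      rw [Finset.prod_congr rfl (g := fun _ => t v)
        (fun j hj => by rw [(Finset.mem_filter.1 hj).2]), Finset.prod_const]
    rw [hexp]
    exact hasSum_fintype _
  have h3 : HasSum (fun k => (p k) fun _ => t) (f t) := by
    have h4 : t ∈ Metric.eball (0 : Fin n → ℂ) r := by
      refine lt_of_lt_of_le ?_ hr'.le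
      rw [edist_zero_right, enorm_eq_nnnorm, ENNReal.coe_lt_coe]
      exact lt_of_lt_of_le ht hρr'
    simpa using hp.hasSum h4
  rw [h3.unique h2]
  exact h1.hasSum

/-! ### Averages over the roots of unity -/

/-- The group of the substitutions `t_v ↦ ζ_v t_v`, `ζ_v ^ d_v = 1`: the deck transformations of
the ramified covering `t ↦ t ^ d`. -/
abbrev DeckGroup {n : ℕ} (d : Fin n → ℕ) : Type := ∀ v, rootsOfUnity (d v) ℂ

noncomputable instance {n : ℕ} (d : Fin n → ℕ) [∀ v, NeZero (d v)] : Fintype (DeckGroup d) :=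
  Fintype.ofFinite _

/-- The point `ζ t`. -/
def deckMul {n : ℕ} {d : Fin n → ℕ} (ζ : DeckGroup d) (t : Fin n → ℂ) : Fin n → ℂ :=
  fun v => ((ζ v : ℂˣ) : ℂ) * t v

theorem deckMul_pow {n : ℕ} {d : Fin n → ℕ} (ζ : DeckGroup d) (t : Fin n → ℂ) (v : Fin n) :
    deckMul ζ t v ^ d v = t v ^ d v := by
  have h : ((ζ v : ℂˣ) : ℂ) ^ d v = 1 := by
    have := (ζ v).2
    rw [mem_rootsOfUnity] at this
    rw [← Units.val_pow_eq_pow_val, this, Units.val_one]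
  rw [deckMul, mul_pow, h, one_mul]

theorem deckMul_mul {n : ℕ} {d : Fin n → ℕ} (ζ ω : DeckGroup d) (t : Fin n → ℂ) :
    deckMul (ζ * ω) t = deckMul ζ (deckMul ω t) := by
  funext v
  simp [deckMul, mul_assoc]

@[simp] theorem deckMul_zero {n : ℕ} {d : Fin n → ℕ} (ζ : DeckGroup d) : deckMul ζ 0 = 0 := by
  funext v
  simp [deckMul]

theorem analyticAt_deckMul {n : ℕ} {d : Fin n → ℕ} (ζ : DeckGroup d) (t : Fin n → ℂ) :
    AnalyticAt ℂ (deckMul ζ) t :=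
  AnalyticAt.pi fun v => analyticAt_const.mul
    ((ContinuousLinearMap.proj (R := ℂ) (φ := fun _ : Fin n => ℂ) v).analyticAt t)

theorem norm_deckMul {n : ℕ} {d : Fin n → ℕ} [∀ v, NeZero (d v)] (ζ : DeckGroup d)
    (t : Fin n → ℂ) : ‖deckMul ζ t‖ = ‖t‖ := by
  have h : ∀ v, ‖deckMul ζ t v‖ = ‖t v‖ := fun v => by
    have := congrArg norm (deckMul_pow ζ t v)
    rw [norm_pow, norm_pow] at this
    exact (pow_left_inj₀ (norm_nonneg _) (norm_nonneg _) (NeZero.ne (d v))).1 this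
  simp only [Pi.norm_def]
  congr 1
  exact Finset.sup_congr rfl fun v _ => NNReal.eq (h v)

open Classical in
/-- A monomial has average zero over the deck transformations unless it is a monomial in the
`t_v ^ d_v`, since it then defines a nontrivial character. -/
theorem sum_deckGroup_prod_pow {n : ℕ} {d : Fin n → ℕ} [∀ v, NeZero (d v)] (γ : Fin n → ℕ) :
    ∑ ζ : DeckGroup d, ∏ v, (((ζ v : ℂˣ) : ℂ)) ^ γ v =
      if ∀ v, d v ∣ γ v then (Fintype.card (DeckGroup d) : ℂ) else 0 := by
  split_ifs with h
  · rw [Finset.sum_congr rfl (g := fun _ => (1 : ℂ))]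
    · simp
    · intro ζ _
      refine Finset.prod_eq_one fun v _ => ?_
      obtain ⟨e, he⟩ := h v
      have := (ζ v).2
      rw [mem_rootsOfUnity] at this
      rw [he, pow_mul, ← Units.val_pow_eq_pow_val, this, Units.val_one, one_pow]
  · push Not at h
    obtain ⟨v, hv⟩ := h
    let χ : DeckGroup d →* ℂ :=
      { toFun := fun ζ => ∏ v, (((ζ v : ℂˣ) : ℂ)) ^ γ v
        map_one' := by simp
        map_mul' := fun ζ ω => by simp [mul_pow, Finset.prod_mul_distrib] }
    refine sum_hom_units_eq_zero χ fun hχ => hv ?_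
    have hprim := Complex.isPrimitiveRoot_exp (d v) (NeZero.ne _)
    have h1 : χ (Pi.mulSingle v hprim.toRootsOfUnity) = 1 := by rw [hχ]; rfl
    have h2 : χ (Pi.mulSingle v hprim.toRootsOfUnity) =
        Complex.exp (2 * Real.pi * Complex.I / (d v)) ^ γ v := by
      change ∏ u : Fin n, _ = _
      rw [Finset.prod_eq_single v]
      · simp
      · intro u _ hu
        simp [Pi.mulSingle_eq_of_ne hu]
      · simp
    rw [h2] at h1
    exact hprim.dvd_of_pow_eq_one _ h1

/-- The average of an analytic function over the deck transformations is an analytic function of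
`t ^ d`. -/
theorem AnalyticAt.exists_average_eq {n : ℕ} (d : Fin n → ℕ) [∀ v, NeZero (d v)]
    {f : (Fin n → ℂ) → ℂ} (hf : AnalyticAt ℂ f 0) :
    ∃ F : (Fin n → ℂ) → ℂ, AnalyticAt ℂ F 0 ∧ ∀ᶠ t in 𝓝 (0 : Fin n → ℂ),
      (Fintype.card (DeckGroup d) : ℂ)⁻¹ * ∑ ζ : DeckGroup d, f (deckMul ζ t) =
        F fun v => t v ^ d v := by
  classical
  obtain ⟨c, γ, ρ, hρ0, hρ1, hs, hsum⟩ := hf.exists_hasSum_monomial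
  let b := fun i => if ∀ v, d v ∣ γ i v then c i else 0
  refine ⟨fun x => ∑' i, b i * ∏ v, x v ^ (γ i v / d v), ?_, ?_⟩
  -- any radius below all the `ρ ^ d_v` serves, and `ρ ≤ 1`
  · refine analyticAt_tsum_monomial b (fun i v => γ i v / d v) (ρ := ρ ^ ∑ v, d v)
      (pow_pos hρ0 _) (Summable.of_nonneg_of_le (fun i => by positivity) (fun i => ?_) hs)
    by_cases h : ∀ v, d v ∣ γ i v
    · simp only [b, if_pos h]
      refine mul_le_mul_of_nonneg_left ?_ (norm_nonneg _)
      push_cast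
      rw [← pow_mul]
      refine pow_le_pow_of_le_one ρ.coe_nonneg (by exact_mod_cast hρ1) ?_
      rw [Finset.mul_sum]
      refine Finset.sum_le_sum fun v _ => ?_
      calc γ i v = d v * (γ i v / d v) := (Nat.mul_div_cancel' (h v)).symm
        _ ≤ _ := Nat.mul_le_mul_right _
          (Finset.single_le_sum (f := d) (fun _ _ => Nat.zero_le _) (Finset.mem_univ v))
    · simp only [b, if_neg h, norm_zero, zero_mul]
      positivity
  · have hball : ∀ᶠ t in 𝓝 (0 : Fin n → ℂ), ‖t‖ < ρ := by
      have := Metric.ball_mem_nhds (0 : Fin n → ℂ) (NNReal.coe_pos.2 hρ0)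
      filter_upwards [this] with t ht
      simpa using ht
    filter_upwards [hball] with t ht
    have h1 := (hasSum_sum (s := Finset.univ) fun (ζ : DeckGroup d) _ =>
      hsum (deckMul ζ t) (by rwa [norm_deckMul])).mul_left (Fintype.card (DeckGroup d) : ℂ)⁻¹
    rw [← h1.tsum_eq]
    refine tsum_congr fun i => ?_
    have h2 : ∀ ζ : DeckGroup d, c i * ∏ v, deckMul ζ t v ^ γ i v =
        c i * (∏ v, t v ^ γ i v) * ∏ v, (((ζ v : ℂˣ) : ℂ)) ^ γ i v := fun ζ => by
      simp only [deckMul, mul_pow, Finset.prod_mul_distrib]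
      ring
    simp only [h2]
    rw [← Finset.mul_sum, sum_deckGroup_prod_pow]
    by_cases h : ∀ v, d v ∣ γ i v
    · have hcard : (Fintype.card (DeckGroup d) : ℂ) ≠ 0 :=
        Nat.cast_ne_zero.2 Fintype.card_ne_zero
      have h3 : ∏ v, (t v ^ d v) ^ (γ i v / d v) = ∏ v, t v ^ γ i v :=
        Finset.prod_congr rfl fun v _ => by rw [← pow_mul, Nat.mul_div_cancel' (h v)]
      simp only [b, if_pos h, h3]
      field_simp
    · simp [b, if_neg h]

/-! ### The norm of a polynomial with analytic coefficients -/

/-- The algebra of the functions that are analytic at the origin of `ℂⁿ`. -/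
def analyticFunctions (n : ℕ) : Subalgebra ℂ ((Fin n → ℂ) → ℂ) where
  carrier := {f | AnalyticAt ℂ f 0}
  mul_mem' hf hg := AnalyticAt.mul hf hg
  add_mem' hf hg := AnalyticAt.add hf hg
  algebraMap_mem' _ := analyticAt_const

/-- Evaluation at the point `t` of the functions that are analytic at the origin. -/
def evalAnalytic {n : ℕ} (t : Fin n → ℂ) : analyticFunctions n →+* ℂ :=
  (Pi.evalRingHom (fun _ : Fin n → ℂ => ℂ) t).comp (analyticFunctions n).val.toRingHom

/-- The action `f ↦ (t ↦ f (ζ t))` of a deck transformation on analytic functions. -/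
def deckPullback {n : ℕ} {d : Fin n → ℕ} (ζ : DeckGroup d) :
    analyticFunctions n →+* analyticFunctions n where
  toFun f := ⟨fun t => f.1 (deckMul ζ t), by
    have hf : AnalyticAt ℂ f.1 (deckMul ζ 0) := by rw [deckMul_zero]; exact f.2
    exact hf.comp (analyticAt_deckMul ζ 0)⟩
  map_one' := rfl
  map_mul' _ _ := rfl
  map_zero' := rfl
  map_add' _ _ := rfl

theorem evalAnalytic_comp_deckPullback {n : ℕ} {d : Fin n → ℕ} (ζ : DeckGroup d)
    (t : Fin n → ℂ) : (evalAnalytic t).comp (deckPullback ζ) = evalAnalytic (deckMul ζ t) := rfl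

/-- The norm of a polynomial with coefficients analytic in `t` has coefficients analytic in
`t ^ d`. -/
theorem exists_analytic_norm {n : ℕ} (d : Fin n → ℕ) [∀ v, NeZero (d v)] {σ : Type*} [Fintype σ]
    (P : MvPolynomial σ (analyticFunctions n)) :
    ∃ H : (Fin n → ℂ) × (σ → ℂ) → ℂ, (∀ᶠ x in 𝓝 (0 : Fin n → ℂ), ∀ z, AnalyticAt ℂ H (x, z)) ∧
      ∀ᶠ t in 𝓝 (0 : Fin n → ℂ), ∀ z, H (fun v => t v ^ d v, z) =
        ∏ ζ : DeckGroup d, P.eval₂ (evalAnalytic (deckMul ζ t)) z := by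
  let Q : MvPolynomial σ (analyticFunctions n) :=
    ∏ ζ : DeckGroup d, MvPolynomial.map (deckPullback ζ) P
  have hQ : ∀ t z, Q.eval₂ (evalAnalytic t) z =
      ∏ ζ : DeckGroup d, P.eval₂ (evalAnalytic (deckMul ζ t)) z := fun t z => by
    simp only [Q, ← MvPolynomial.coe_eval₂Hom, map_prod]
    refine Finset.prod_congr rfl fun ζ _ => ?_
    rw [MvPolynomial.coe_eval₂Hom, MvPolynomial.eval₂_map, evalAnalytic_comp_deckPullback,
      MvPolynomial.coe_eval₂Hom]
  have hinv : ∀ (ω : DeckGroup d) t z,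
      Q.eval₂ (evalAnalytic (deckMul ω t)) z = Q.eval₂ (evalAnalytic t) z := fun ω t z => by
    rw [hQ, hQ]
    simp only [← deckMul_mul]
    exact Fintype.prod_equiv (Equiv.mulRight ω) _ _ fun ζ => rfl
  choose C hCan hC using fun m => (Q.coeff m).2.exists_average_eq d
  refine ⟨fun p => ∑ m ∈ Q.support, C m p.1 * ∏ i, p.2 i ^ m i, ?_, ?_⟩
  · have h1 : ∀ᶠ x in 𝓝 (0 : Fin n → ℂ), ∀ m ∈ Q.support, AnalyticAt ℂ (C m) x :=
      (eventually_all_finset _).2 fun m _ => (hCan m).eventually_analyticAt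
    filter_upwards [h1] with x hx z
    refine Finset.analyticAt_fun_sum _ fun m hm => ?_
    refine AnalyticAt.mul ((hx m hm).comp_of_eq analyticAt_fst rfl) ?_
    refine Finset.analyticAt_fun_prod _ fun i _ => AnalyticAt.pow ?_ _
    exact ((ContinuousLinearMap.proj (R := ℂ) (φ := fun _ : σ => ℂ) i).comp
      (ContinuousLinearMap.snd ℂ (Fin n → ℂ) (σ → ℂ))).analyticAt (x, z)
  · have h1 : ∀ᶠ t in 𝓝 (0 : Fin n → ℂ), ∀ m ∈ Q.support,
        (Fintype.card (DeckGroup d) : ℂ)⁻¹ * ∑ ζ : DeckGroup d, (Q.coeff m).1 (deckMul ζ t) =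
          C m fun v => t v ^ d v := (eventually_all_finset _).2 fun m _ => hC m
    filter_upwards [h1] with t ht z
    rw [← hQ]
    have hcard : (Fintype.card (DeckGroup d) : ℂ) ≠ 0 := Nat.cast_ne_zero.2 Fintype.card_ne_zero
    have h2 : Q.eval₂ (evalAnalytic t) z = (Fintype.card (DeckGroup d) : ℂ)⁻¹ *
        ∑ ω : DeckGroup d, Q.eval₂ (evalAnalytic (deckMul ω t)) z := by
      simp only [hinv, Finset.sum_const, Finset.card_univ, nsmul_eq_mul]
      field_simp
    rw [h2]
    -- averaging the invariant polynomial `Q` averages each of its coefficients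
    simp only [MvPolynomial.eval₂_eq']
    rw [Finset.sum_comm, Finset.mul_sum]
    refine Finset.sum_congr rfl fun m hm => ?_
    rw [← ht m hm, ← Finset.sum_mul, mul_assoc]
    rfl

/-- The norm of `∏ (ξ_v + η α_v) ^ e_v - η ^ E ψ`, a polynomial in the covector `(ξ, η)`. -/
theorem exists_covector_equation {n : ℕ} (d : Fin n → ℕ) [∀ v, NeZero (d v)] (I : Finset (Fin n))
    (e : Fin n → ℕ) (E : ℕ) (α : Fin n → (Fin n → ℂ) → ℂ) (ψ : (Fin n → ℂ) → ℂ)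
    (hα : ∀ v, AnalyticAt ℂ (α v) 0) (hψ : AnalyticAt ℂ ψ 0) :
    ∃ H : (Fin n → ℂ) × Cspace n → ℂ, (∀ᶠ x in 𝓝 (0 : Fin n → ℂ), ∀ z, AnalyticAt ℂ H (x, z)) ∧
      ∀ᶠ t in 𝓝 (0 : Fin n → ℂ), ∀ z : Cspace n, H (fun v => t v ^ d v, z) =
        ∏ ζ : DeckGroup d, (∏ v ∈ I, (z.1 v + z.2 * α v (deckMul ζ t)) ^ e v -
          z.2 ^ E * ψ (deckMul ζ t)) := by
  let P : MvPolynomial (Option (Fin n)) (analyticFunctions n) :=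
    ∏ v ∈ I, (MvPolynomial.X (some v) + MvPolynomial.X none * MvPolynomial.C ⟨α v, hα v⟩) ^ e v -
      MvPolynomial.X none ^ E * MvPolynomial.C ⟨ψ, hψ⟩
  obtain ⟨H, hH, hHP⟩ := exists_analytic_norm d P
  refine ⟨fun p => H (p.1, fun o => o.elim p.2.2 p.2.1), ?_, ?_⟩
  · filter_upwards [hH] with x hx z
    refine (hx _).comp_of_eq (f := fun p : (Fin n → ℂ) × Cspace n =>
      ((p.1, fun o => o.elim p.2.2 p.2.1) : (Fin n → ℂ) × (Option (Fin n) → ℂ))) ?_ rfl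
    refine analyticAt_fst.prod (AnalyticAt.pi fun o => ?_)
    cases o with
    | none => exact ((ContinuousLinearMap.snd ℂ (Fin n → ℂ) ℂ).comp
        (ContinuousLinearMap.snd ℂ (Fin n → ℂ) (Cspace n))).analyticAt (x, z)
    | some v => exact ((ContinuousLinearMap.proj (R := ℂ) (φ := fun _ : Fin n => ℂ) v).comp
        ((ContinuousLinearMap.fst ℂ (Fin n → ℂ) ℂ).comp
          (ContinuousLinearMap.snd ℂ (Fin n → ℂ) (Cspace n)))).analyticAt (x, z)
  · filter_upwards [hHP] with t ht z
    rw [ht]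
    refine Finset.prod_congr rfl fun ζ _ => ?_
    simp only [P, ← MvPolynomial.coe_eval₂Hom, map_sub, map_mul, map_prod, map_pow, map_add]
    simp only [MvPolynomial.coe_eval₂Hom, MvPolynomial.eval₂_X, MvPolynomial.eval₂_C]
    rfl

/-! ### The derivatives of the parametrization -/

theorem analyticAt_monomial {n : ℕ} (D : Fin n → ℕ) (t : Fin n → ℂ) :
    AnalyticAt ℂ (fun t : Fin n → ℂ => ∏ w, t w ^ D w) t :=
  Finset.analyticAt_fun_prod _ fun w _ =>
    ((ContinuousLinearMap.proj (R := ℂ) (φ := fun _ : Fin n => ℂ) w).analyticAt t).pow _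

theorem analyticAt_powers {n : ℕ} (q : Fin n → ℕ) (t : Fin n → ℂ) :
    AnalyticAt ℂ (fun (t : Fin n → ℂ) w => t w ^ q w) t :=
  AnalyticAt.pi fun w =>
    ((ContinuousLinearMap.proj (R := ℂ) (φ := fun _ : Fin n => ℂ) w).analyticAt t).pow _

theorem AnalyticAt.comp_powers {n : ℕ} {F : Type*} [NormedAddCommGroup F] [NormedSpace ℂ F]
    {g : (Fin n → ℂ) → F} (hg : AnalyticAt ℂ g 0) {q : Fin n → ℕ} (hq : ∀ w, q w ≠ 0) :
    AnalyticAt ℂ (fun t : Fin n → ℂ => g fun w => t w ^ q w) 0 :=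
  hg.comp_of_eq (analyticAt_powers q 0) (by ext w; simp [hq w])

theorem powers_update {n : ℕ} (q : Fin n → ℕ) (t : Fin n → ℂ) (v : Fin n) (s : ℂ) :
    (fun w => Function.update t v s w ^ q w) =
      Function.update (fun w => t w ^ q w) v (s ^ q v) := by
  ext w
  rcases eq_or_ne w v with rfl | h
  · simp
  · simp [Function.update_of_ne h]

/-- The logarithmic derivative of a monomial times an analytic function of powers of the
variables. -/
theorem mul_fderiv_monomial_mul {n : ℕ} {g : (Fin n → ℂ) → ℂ} (hg : AnalyticAt ℂ g 0)
    (D : Fin n → ℕ) {q : Fin n → ℕ} (hq : ∀ w, q w ≠ 0) (v : Fin n) :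
    ∀ᶠ t in 𝓝 (0 : Fin n → ℂ),
      t v * fderiv ℂ (fun t : Fin n → ℂ => (∏ w, t w ^ D w) * g fun w => t w ^ q w) t
        (Pi.single v 1) =
      (∏ w, t w ^ D w) * (D v * g (fun w => t w ^ q w) +
        q v * t v ^ q v * fderiv ℂ g (fun w => t w ^ q w) (Pi.single v 1)) := by
  have h1 : ∀ᶠ t in 𝓝 (0 : Fin n → ℂ), AnalyticAt ℂ g fun w => t w ^ q w :=
    (analyticAt_powers q 0).continuousAt.eventually
      (by simpa [hq, Pi.zero_def] using hg.eventually_analyticAt)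
  filter_upwards [h1] with t ht
  let T := fun t : Fin n → ℂ => (∏ w, t w ^ D w) * g fun w => t w ^ q w
  have hT : HasDerivAt (fun s => T (Function.update t v s)) (fderiv ℂ T t (Pi.single v 1))
      (t v) := by
    have h2 : AnalyticAt ℂ T t := (analyticAt_monomial D t).mul
      (ht.comp_of_eq (analyticAt_powers q t) rfl)
    have h3 : HasFDerivAt T (fderiv ℂ T t) (Function.update t v (t v)) := by
      rw [Function.update_eq_self]
      exact h2.differentiableAt.hasFDerivAt
    exact h3.comp_hasDerivAt (t v) (hasDerivAt_update t v (t v))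
  have hT' : HasDerivAt (fun s => T (Function.update t v s))
      ((∏ w ∈ Finset.univ.erase v, t w ^ D w) * (D v * t v ^ (D v - 1)) * g (fun w => t w ^ q w) +
        (∏ w ∈ Finset.univ.erase v, t w ^ D w) * t v ^ D v *
          (q v * t v ^ (q v - 1) * fderiv ℂ g (fun w => t w ^ q w) (Pi.single v 1))) (t v) := by
    have h4 : ∀ s, T (Function.update t v s) =
        ((∏ w ∈ Finset.univ.erase v, t w ^ D w) * s ^ D v) *
          g (Function.update (fun w => t w ^ q w) v (s ^ q v)) := fun s => by
      simp only [T]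
      rw [powers_update q]
      congr 1
      rw [← Finset.mul_prod_erase _ _ (Finset.mem_univ v), Function.update_self, mul_comm]
      congr 1
      exact Finset.prod_congr rfl fun w hw => by
        rw [Function.update_of_ne (Finset.ne_of_mem_erase hw)]
    simp only [h4]
    have h5 : HasDerivAt (fun s : ℂ => Function.update (fun w => t w ^ q w) v (s ^ q v))
        ((q v * t v ^ (q v - 1) : ℂ) • (Pi.single v 1 : Fin n → ℂ)) (t v) :=
      (hasDerivAt_update (fun w => t w ^ q w) v (t v ^ q v)).scomp (t v) (hasDerivAt_pow _ _)
    have h6 : HasFDerivAt g (fderiv ℂ g fun w => t w ^ q w)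
        (Function.update (fun w => t w ^ q w) v (t v ^ q v)) := by
      rw [Function.update_eq_self_iff.2 rfl]
      exact ht.differentiableAt.hasFDerivAt
    have h7 := h6.comp_hasDerivAt (t v) h5
    rw [map_smul, smul_eq_mul] at h7
    have h8 := ((hasDerivAt_pow (D v) (t v)).const_mul
      (∏ w ∈ Finset.univ.erase v, t w ^ D w)).mul h7
    rw [show (g ∘ fun s : ℂ => Function.update (fun w => t w ^ q w) v (s ^ q v)) (t v) =
      g (fun w => t w ^ q w) by
        rw [Function.comp_apply, Function.update_eq_self_iff.2 rfl]] at h8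
    exact h8
  have h9 : ∏ w, t w ^ D w = t v ^ D v * ∏ w ∈ Finset.univ.erase v, t w ^ D w :=
    (Finset.mul_prod_erase _ _ (Finset.mem_univ v)).symm
  have h10 : (D v : ℂ) * t v ^ (D v - 1) * t v = D v * t v ^ D v := by
    rcases Nat.eq_zero_or_pos (D v) with h | h
    · simp [h]
    · rw [mul_assoc, ← pow_succ, Nat.sub_add_cancel h]
  have h11 : t v ^ (q v - 1) * t v = t v ^ q v := by
    rw [← pow_succ, Nat.sub_add_cancel (Nat.pos_of_ne_zero (hq v))]
  change t v * fderiv ℂ T t (Pi.single v 1) = _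
  rw [hT.unique hT', h9]
  linear_combination (g (fun w => t w ^ q w) * ∏ w ∈ Finset.univ.erase v, t w ^ D w) * h10 +
    ((∏ w ∈ Finset.univ.erase v, t w ^ D w) * t v ^ D v * q v *
      fderiv ℂ g (fun w => t w ^ q w) (Pi.single v 1)) * h11

theorem ramIndex_ne_zero {n m : ℕ} (N : Fin (m + 1) → Fin n → ℚ≥0) (i : Fin (m + 1))
    (v : Fin n) : ramIndex N i v ≠ 0 := by
  rw [ramIndex, Ne, Finset.lcm_eq_zero_iff]
  simp

theorem ramIndex_dvd_last {n m : ℕ} (N : Fin (m + 1) → Fin n → ℚ≥0) (i : Fin (m + 1))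
    (v : Fin n) : ramIndex N i v ∣ ramIndex N (Fin.last m) v :=
  Finset.lcm_mono (Finset.Iic_subset_Iic.2 (Fin.le_last i))

/-- The exponent of `t_v = x_v ^ (1 / d_v)` in the monomial `N i`, where `d_v` is the last
ramification index. The rational number `N i v * d_v` is an integer, hence equal to its
numerator. -/
noncomputable def liftedExponent {n m : ℕ} (N : Fin (m + 1) → Fin n → ℚ≥0) (i : Fin (m + 1))
    (v : Fin n) : ℕ :=
  (N i v * (ramIndex N (Fin.last m) v : ℚ≥0)).num

theorem liftedExponent_eq {n m : ℕ} (N : Fin (m + 1) → Fin n → ℚ≥0) (i : Fin (m + 1))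
    (v : Fin n) : (liftedExponent N i v : ℚ≥0) = N i v * (ramIndex N (Fin.last m) v : ℚ≥0) := by
  have h1 : (N i v).den ∣ ramIndex N (Fin.last m) v :=
    Finset.dvd_lcm (f := fun j => (N j v).den) (Finset.mem_Iic.2 (Fin.le_last i))
  obtain ⟨c, hc⟩ := h1
  have h2 : N i v * (ramIndex N (Fin.last m) v : ℚ≥0) = (((N i v).num * c : ℕ) : ℚ≥0) := by
    rw [hc]
    push_cast
    rw [← mul_assoc, NNRat.mul_den_eq_num]
  rw [liftedExponent, h2, NNRat.num_natCast]

theorem liftedExponent_mono {n m : ℕ} {N : Fin (m + 1) → Fin n → ℚ≥0} (hN : Monotone N) :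
    Monotone (liftedExponent N) := fun i j hij v => by
  rw [← Nat.cast_le (α := ℚ≥0), liftedExponent_eq, liftedExponent_eq]
  exact mul_le_mul_left (hN hij v) _

theorem ramIndex_div_ne_zero {n m : ℕ} (N : Fin (m + 1) → Fin n → ℚ≥0) (i : Fin (m + 1))
    (v : Fin n) : ramIndex N (Fin.last m) v / ramIndex N i v ≠ 0 :=
  (Nat.div_pos (Nat.le_of_dvd (Nat.pos_of_ne_zero (ramIndex_ne_zero _ _ _))
    (ramIndex_dvd_last N i v)) (Nat.pos_of_ne_zero (ramIndex_ne_zero _ _ _))).ne'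

theorem prod_pow_zero_eq_zero {n m : ℕ} {N : Fin (m + 1) → Fin n → ℚ≥0} (h0 : N 0 = 0)
    (hN : StrictMono N) (i : Fin m) : ∏ w, (0 : Fin n → ℂ) w ^ liftedExponent N i.succ w = 0 := by
  have h1 : N 0 < N i.succ := hN (Fin.succ_pos _)
  obtain ⟨w, hw⟩ : ∃ w, N i.succ w ≠ 0 := by
    by_contra hcon
    push Not at hcon
    exact h1.ne (by rw [h0]; exact (funext hcon).symm)
  refine Finset.prod_eq_zero (Finset.mem_univ w) ?_
  rw [Pi.zero_apply, zero_pow]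
  rw [← Nat.cast_ne_zero (R := ℚ≥0), liftedExponent_eq]
  exact mul_ne_zero hw (Nat.cast_ne_zero.2 (ramIndex_ne_zero _ _ _))

theorem analyticAt_ramifiedSum {n m : ℕ} (N : Fin (m + 1) → Fin n → ℚ≥0)
    {G : Fin m → (Fin n → ℂ) → ℂ} (hG : ∀ i, AnalyticAt ℂ (G i) 0) :
    AnalyticAt ℂ (ramifiedSum N G) 0 :=
  Finset.analyticAt_fun_sum _ fun i _ => (analyticAt_monomial (liftedExponent N i.succ) 0).mul
    ((hG i).comp_powers fun w => ramIndex_div_ne_zero N i.succ w)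

theorem ramifiedSum_zero {n m : ℕ} {N : Fin (m + 1) → Fin n → ℚ≥0} (h0 : N 0 = 0)
    (hN : StrictMono N) (G : Fin m → (Fin n → ℂ) → ℂ) : ramifiedSum N G 0 = 0 :=
  Finset.sum_eq_zero fun i _ => by
    have := prod_pow_zero_eq_zero h0 hN i
    simp only [liftedExponent] at this
    rw [this, zero_mul]

/-- If `x_v` does not occur in the monomials before `N_i`, then the terms of `φ` before `N_i` are
analytic in `x_v` itself, so that `x_v ∂φ/∂x_v` is, up to a multiple of `N_i`, the product of `x_v`
with a function that vanishes at the origin. -/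
theorem exists_logDeriv_ramifiedSum {n m : ℕ} {N : Fin (m + 1) → Fin n → ℚ≥0} (h0 : N 0 = 0)
    (hN : StrictMono N) {G : Fin m → (Fin n → ℂ) → ℂ} (hG : ∀ i, AnalyticAt ℂ (G i) 0)
    (i : Fin m) (v : Fin n) (hv : ∀ j < i, N j.succ v = 0) :
    ∃ α β : (Fin n → ℂ) → ℂ, AnalyticAt ℂ α 0 ∧ AnalyticAt ℂ β 0 ∧ α 0 = 0 ∧
      ∀ᶠ t in 𝓝 (0 : Fin n → ℂ), t v * fderiv ℂ (ramifiedSum N G) t (Pi.single v 1) =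
        (ramIndex N (Fin.last m) v : ℂ) * t v ^ ramIndex N (Fin.last m) v * α t +
          (∏ w, t w ^ liftedExponent N i.succ w) * β t := by
  classical
  let q : Fin m → Fin n → ℕ := fun j w => ramIndex N (Fin.last m) w / ramIndex N j.succ w
  have hq : ∀ j w, q j w ≠ 0 := fun j w => ramIndex_div_ne_zero N j.succ w
  let D : Fin m → Fin n → ℕ := fun j => liftedExponent N j.succ
  let dG : Fin m → (Fin n → ℂ) → ℂ := fun j t =>
    fderiv ℂ (G j) (fun w => t w ^ q j w) (Pi.single v 1)
  have hdG : ∀ j, AnalyticAt ℂ (dG j) 0 := fun j =>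
    ((ContinuousLinearMap.apply ℂ ℂ (Pi.single v 1 : Fin n → ℂ)).analyticAt _).comp
      ((hG j).fderiv.comp_powers (hq j))
  have hGq : ∀ j, AnalyticAt ℂ (fun t : Fin n → ℂ => G j fun w => t w ^ q j w) 0 := fun j =>
    (hG j).comp_powers (hq j)
  have hpv : ∀ r : ℕ, AnalyticAt ℂ (fun t : Fin n → ℂ => t v ^ r) 0 := fun r =>
    ((ContinuousLinearMap.proj (R := ℂ) (φ := fun _ : Fin n => ℂ) v).analyticAt 0).pow _
  have hterm : ∀ j, AnalyticAt ℂ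
      (fun t : Fin n → ℂ => (∏ w, t w ^ D j w) * G j fun w => t w ^ q j w) 0 := fun j =>
    (analyticAt_monomial _ _).mul (hGq j)
  refine ⟨fun t => ∑ j ∈ Finset.univ.filter (· < i), (∏ w, t w ^ D j w) * dG j t,
    fun t => ∑ j ∈ Finset.univ.filter (¬ · < i), (∏ w, t w ^ (D j w - D i w)) *
      (D j v * G j (fun w => t w ^ q j w) + q j v * t v ^ q j v * dG j t), ?_, ?_, ?_, ?_⟩
  · exact Finset.analyticAt_fun_sum _ fun j _ => (analyticAt_monomial _ _).mul (hdG j)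
  · exact Finset.analyticAt_fun_sum _ fun j _ => (analyticAt_monomial _ _).mul
      ((analyticAt_const.mul (hGq j)).add ((analyticAt_const.mul (hpv _)).mul (hdG j)))
  · exact Finset.sum_eq_zero fun j _ => by
      rw [show ∏ w, (0 : Fin n → ℂ) w ^ D j w = 0 from prod_pow_zero_eq_zero h0 hN j, zero_mul]
  -- the terms `j < i` give `α`, since `t_v` enters them through `x_v = t_v ^ d_v` only
  · have h1 := eventually_all.2 fun j => mul_fderiv_monomial_mul (hG j) (D j) (hq j) v
    have h2 := eventually_all.2 fun j => (hterm j).eventually_analyticAt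
    filter_upwards [h1, h2] with t ht1 ht2
    have h3 : fderiv ℂ (ramifiedSum N G) t = ∑ j, fderiv ℂ
        (fun t : Fin n → ℂ => (∏ w, t w ^ D j w) * G j fun w => t w ^ q j w) t :=
      fderiv_fun_sum fun j _ => (ht2 j).differentiableAt
    rw [h3, sum_apply, Finset.mul_sum, Finset.sum_congr rfl fun j _ => ht1 j,
      ← Finset.sum_filter_add_sum_filter_not Finset.univ (· < i)]
    congr 1
    · rw [Finset.mul_sum]
      refine Finset.sum_congr rfl fun j hj => ?_
      have hji := (Finset.mem_filter.1 hj).2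
      have hD : D j v = 0 := by
        rw [← Nat.cast_eq_zero (R := ℚ≥0), liftedExponent_eq, hv j hji, zero_mul]
      have hram : ramIndex N j.succ v = 1 := by
        refine Nat.dvd_one.1 (Finset.lcm_dvd fun l hl => ?_)
        have h4 : N l v = 0 :=
          le_antisymm ((hN.monotone (Finset.mem_Iic.1 hl) v).trans_eq (hv j hji)) (zero_le)
        simp [h4]
      have hqv : q j v = ramIndex N (Fin.last m) v := by
        simp only [q, hram, Nat.div_one]
      rw [hD, hqv]
      push_cast
      simp only [dG]
      ring
    · rw [Finset.mul_sum]
      refine Finset.sum_congr rfl fun j hj => ?_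
      have hij : i ≤ j := not_lt.1 (Finset.mem_filter.1 hj).2
      have h5 : ∏ w, t w ^ D j w = (∏ w, t w ^ D i w) * ∏ w, t w ^ (D j w - D i w) := by
        rw [← Finset.prod_mul_distrib]
        refine Finset.prod_congr rfl fun w _ => ?_
        rw [← pow_add, Nat.add_sub_cancel' (liftedExponent_mono hN.monotone
          (Fin.succ_le_succ_iff.2 hij) w)]
      rw [h5]
      simp only [D, dG]
      ring

/-! ### Very special monomials -/

theorem verySpecialMonomial_eq {n m : ℕ} (N : Fin (m + 1) → Fin n → ℚ≥0) {k : ℕ}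
    (h : k < (verySpecialIndices N).card) : verySpecialMonomial N (k + 1) =
      N ((verySpecialIndices N).orderEmbOfFin rfl ⟨k, h⟩).succ := by
  rw [verySpecialMonomial, dif_pos h]

/-- A variable enters at a very special monomial. -/
theorem mem_verySpecialIndices {n m : ℕ} {N : Fin (m + 1) → Fin n → ℚ≥0} {i : Fin m} {v : Fin n}
    (h1 : N i.succ v ≠ 0) (h0 : N i.castSucc v = 0) : i ∈ verySpecialIndices N := by
  classical
  rw [verySpecialIndices, Finset.mem_filter]
  refine ⟨Finset.mem_univ _, fun h => ?_⟩
  have h2 : Function.update (1 : Fin n → ℂ) v 0 ∈ monomialZeroSet (N i.succ) :=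
    ⟨v, h1, by simp⟩
  rw [h] at h2
  obtain ⟨w, hw, hw0⟩ := h2
  rcases eq_or_ne w v with rfl | hwv
  · exact hw h0
  · simp [Function.update_of_ne hwv] at hw0

/-- A variable that is new in `M_k` does not occur in the special monomials before `M_k`, and for
`k ≥ 2` some variable of `M_k` is not new. -/
theorem exists_index_verySpecialMonomial {n m : ℕ} {N : Fin (m + 1) → Fin n → ℚ≥0}
    (h0 : N 0 = 0) (hN : StrictMono N) {k : ℕ} (hk1 : 1 ≤ k) (hkg : k ≤ numVerySpecial N) :
    ∃ i : Fin m, verySpecialMonomial N k = N i.succ ∧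
      (∀ v ∈ newVariables N k, ∀ j < i, N j.succ v = 0) ∧
      (2 ≤ k → ∃ w ∉ newVariables N k, verySpecialMonomial N k w ≠ 0) := by
  obtain ⟨k, rfl⟩ : ∃ l, k = l + 1 := ⟨k - 1, by omega⟩
  have hk : k < (verySpecialIndices N).card := hkg
  set emb := (verySpecialIndices N).orderEmbOfFin rfl with hemb
  refine ⟨emb ⟨k, hk⟩, verySpecialMonomial_eq N hk, fun v hv j hj => ?_, fun hk2 => ?_⟩
  · by_contra hjv
    rw [newVariables, Finset.mem_filter, Nat.add_sub_cancel] at hv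
    obtain ⟨j0, hj0, hmin⟩ := WellFounded.has_min (wellFounded_lt (α := Fin m))
      {j | N j.succ v ≠ 0} ⟨j, hjv⟩
    have hj0j : j0 ≤ j := not_lt.1 (hmin j hjv)
    have hcast : N j0.castSucc v = 0 := by
      by_cases hz : (j0 : ℕ) = 0
      · have : j0.castSucc = 0 := Fin.ext (by simpa using hz)
        rw [this, h0, Pi.zero_apply]
      · by_contra hne
        let j1 : Fin m := ⟨j0 - 1, by omega⟩
        have h1 : j1.succ = j0.castSucc := Fin.ext (by simp [j1]; omega)
        refine hmin j1 ?_ (Fin.lt_def.2 (by simp only [j1]; omega))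
        rw [Set.mem_ofPred_eq, h1]
        exact hne
    have hmem := mem_verySpecialIndices hj0 hcast
    obtain ⟨l, hl⟩ : ∃ l, emb l = j0 := by
      have : j0 ∈ Set.range emb := by
        rw [hemb, Finset.range_orderEmbOfFin]
        exact hmem
      exact this
    have hlk : l < ⟨k, hk⟩ := by
      rw [← emb.lt_iff_lt, hl]
      exact hj0j.trans_lt hj
    have hlk' : (l : ℕ) < k := hlk
    obtain ⟨k, rfl⟩ : ∃ l, k = l + 1 := ⟨k - 1, by omega⟩
    have h2 := hv.2.2
    rw [verySpecialMonomial_eq N (by omega : k < _)] at h2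
    have h3 : j0 ≤ emb ⟨k, by omega⟩ := by
      rw [← hl, emb.le_iff_le]
      exact Fin.le_def.2 (by simp only []; omega)
    have h4 := hN.monotone (Fin.succ_le_succ_iff.2 h3) v
    rw [← hemb] at h2
    rw [h2] at h4
    exact hj0 (le_antisymm h4 (zero_le))
  · obtain ⟨k, rfl⟩ : ∃ l, k = l + 1 := ⟨k - 1, by omega⟩
    have hk' : k < (verySpecialIndices N).card := by omega
    have h1 : N 0 < N (emb ⟨k, hk'⟩).succ := hN (Fin.succ_pos _)
    obtain ⟨w, hw⟩ : ∃ w, N (emb ⟨k, hk'⟩).succ w ≠ 0 := by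
      by_contra hcon
      push Not at hcon
      exact h1.ne (by rw [h0]; exact (funext hcon).symm)
    refine ⟨w, fun hmem => ?_, ?_⟩
    · rw [newVariables, Finset.mem_filter, Nat.add_sub_cancel] at hmem
      rw [verySpecialMonomial_eq N hk'] at hmem
      exact hw hmem.2.2
    · rw [verySpecialMonomial_eq N hk]
      have h2 : emb ⟨k, hk'⟩ ≤ emb ⟨k + 1, hk⟩ := by
        rw [emb.le_iff_le]
        exact Fin.le_def.2 (by simp)
      have h4 := hN.monotone (Fin.succ_le_succ_iff.2 h2) w
      exact fun h5 => hw (le_antisymm (h4.trans_eq h5) (zero_le))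

/-! ### The equation of the tangent hyperplanes -/

/-- Powers of the covector coordinates for which the ramification cancels: `e_v` is proportional
to the exponent `a_v`, so that `∏ x_v ^ e_v` over `I` divides the `(∑ e_v)`-th power of
`∏ x_v ^ a_v` as soon as the sum of the `a_v` over `I` is at least one. The quotient
`∏ t_w ^ Q_w` vanishes at the
origin. -/
theorem exists_balanced_powers {n : ℕ} (a : Fin n → ℚ≥0) (d D : Fin n → ℕ) (I : Finset (Fin n))
    (hd : ∀ v, d v ≠ 0) (hD : ∀ v, (D v : ℚ≥0) = a v * d v) (hS : 1 ≤ ∑ v ∈ I, a v)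
    (hw : ∃ w, a w ≠ 0 ∧ (w ∉ I ∨ 1 < ∑ v ∈ I, a v)) :
    ∃ e Q : Fin n → ℕ, (∃ w, Q w ≠ 0) ∧ ∀ t : Fin n → ℂ, (∏ w, t w ^ D w) ^ (∑ v ∈ I, e v) =
      (∏ v ∈ I, (t v ^ d v) ^ e v) * ∏ w, t w ^ Q w := by
  classical
  let K : ℕ := ∏ v, (a v).den
  have hK : K ≠ 0 := Finset.prod_ne_zero_iff.2 fun v _ => (a v).den_ne_zero
  let e : Fin n → ℕ := fun v => (a v).num * ∏ w ∈ Finset.univ.erase v, (a w).den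
  have he : ∀ v, (e v : ℚ≥0) = a v * K := fun v => by
    simp only [e, K]
    rw [← Finset.mul_prod_erase _ _ (Finset.mem_univ v)]
    push_cast
    rw [← mul_assoc, NNRat.mul_den_eq_num]
  have hE : ((∑ v ∈ I, e v : ℕ) : ℚ≥0) = (∑ v ∈ I, a v) * K := by
    push_cast
    rw [Finset.sum_mul]
    exact Finset.sum_congr rfl fun v _ => he v
  have hDE : ∀ w, ((D w * ∑ v ∈ I, e v : ℕ) : ℚ≥0) = (∑ v ∈ I, a v) * (d w * e w : ℕ) :=
    fun w => by
      rw [Nat.cast_mul, Nat.cast_mul, hE, hD, he]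
      ring
  have hle : ∀ w, d w * e w ≤ D w * ∑ v ∈ I, e v := fun w => by
    rw [← Nat.cast_le (α := ℚ≥0), hDE]
    exact le_mul_of_one_le_left (zero_le) hS
  refine ⟨e, fun w => D w * (∑ v ∈ I, e v) - if w ∈ I then d w * e w else 0, ?_, fun t => ?_⟩
  · obtain ⟨w, hw0, hw1⟩ := hw
    have hpos : 0 < d w * e w := by
      refine Nat.mul_pos (Nat.pos_of_ne_zero (hd w)) (Nat.pos_of_ne_zero ?_)
      rw [← Nat.cast_ne_zero (R := ℚ≥0), he]
      exact mul_ne_zero hw0 (Nat.cast_ne_zero.2 hK)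
    refine ⟨w, (Nat.sub_pos_of_lt ?_).ne'⟩
    split_ifs with hwI
    · have h1 := hw1.resolve_left (not_not.2 hwI)
      rw [← Nat.cast_lt (α := ℚ≥0), hDE]
      exact lt_mul_of_one_lt_left (Nat.cast_pos.2 hpos) h1
    · exact hpos.trans_le (hle w)
  · have h1 : ∏ v ∈ I, (t v ^ d v) ^ e v = ∏ w, t w ^ (if w ∈ I then d w * e w else 0) := by
      rw [← Finset.prod_subset (Finset.subset_univ I)
        (fun w _ hw => by rw [if_neg hw, pow_zero])]
      exact Finset.prod_congr rfl fun v hv => by rw [if_pos hv, pow_mul (t v)]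
    rw [h1, ← Finset.prod_mul_distrib, ← Finset.prod_pow]
    refine Finset.prod_congr rfl fun w _ => ?_
    rw [← pow_mul, ← pow_add]
    congr 1
    refine (Nat.add_sub_cancel' ?_).symm
    split_ifs
    · exact hle w
    · exact Nat.zero_le _

/-- The chain rule for the equation `f (t ^ d, φ t) = 0`. -/
theorem gradientVec_parametrization {n : ℕ} {f : Cspace n → ℂ} {φ : (Fin n → ℂ) → ℂ}
    {d : Fin n → ℕ} {t : Fin n → ℂ} (hφ : DifferentiableAt ℂ φ t)
    (hf : DifferentiableAt ℂ f (fun v => t v ^ d v, φ t))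
    (h0 : ∀ᶠ s in 𝓝 t, f (fun v => s v ^ d v, φ s) = 0) (v : Fin n) :
    d v * t v ^ (d v - 1) * (gradientVec f (fun v => t v ^ d v, φ t)).1 v +
      (gradientVec f (fun v => t v ^ d v, φ t)).2 * fderiv ℂ φ t (Pi.single v 1) = 0 := by
  have h1 : HasDerivAt (fun s : ℂ => (fun w => Function.update t v s w ^ d w))
      ((d v * t v ^ (d v - 1) : ℂ) • (Pi.single v 1 : Fin n → ℂ)) (t v) := by
    rw [show (fun s : ℂ => (fun w => Function.update t v s w ^ d w)) =
      fun s => Function.update (fun w => t w ^ d w) v (s ^ d v) from funext (powers_update d t v)]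
    exact (hasDerivAt_update (fun w => t w ^ d w) v (t v ^ d v)).scomp (t v) (hasDerivAt_pow _ _)
  have h2 : HasDerivAt (fun s => φ (Function.update t v s)) (fderiv ℂ φ t (Pi.single v 1))
      (t v) := by
    have h3 : HasFDerivAt φ (fderiv ℂ φ t) (Function.update t v (t v)) := by
      rw [Function.update_eq_self]
      exact hφ.hasFDerivAt
    exact h3.comp_hasDerivAt (t v) (hasDerivAt_update t v (t v))
  have h4 : HasFDerivAt f (fderiv ℂ f (fun v => t v ^ d v, φ t))
      ((fun w => Function.update t v (t v) w ^ d w), φ (Function.update t v (t v))) := by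
    rw [Function.update_eq_self]
    exact hf.hasFDerivAt
  have h5 := h4.comp_hasDerivAt (t v) (h1.prodMk h2)
  have hcont : Tendsto (fun s => Function.update t v s) (𝓝 (t v)) (𝓝 t) := by
    have := (hasDerivAt_update t v (t v)).continuousAt.tendsto
    rwa [Function.update_eq_self] at this
  have h6 : HasDerivAt (f ∘ fun s => ((fun w => Function.update t v s w ^ d w),
      φ (Function.update t v s))) 0 (t v) :=
    (hasDerivAt_const (t v) (0 : ℂ)).congr_of_eventuallyEq (hcont.eventually h0)
  have h7 := h5.unique h6
  have h8 : ((d v * t v ^ (d v - 1) : ℂ) • (Pi.single v 1 : Fin n → ℂ),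
      fderiv ℂ φ t (Pi.single v 1)) =
        (d v * t v ^ (d v - 1) : ℂ) • ((Pi.single v 1, 0) : Cspace n) +
        (fderiv ℂ φ t (Pi.single v 1)) • ((0, 1) : Cspace n) := by
    simp
  rw [h8, map_add, map_smul, map_smul, smul_eq_mul, smul_eq_mul] at h7
  rw [← h7, gradientVec]
  ring

theorem AnalyticAt.gradientVec {n : ℕ} {f : Cspace n → ℂ} {q : Cspace n} (hf : AnalyticAt ℂ f q) :
    AnalyticAt ℂ (gradientVec f) q :=
  (AnalyticAt.pi fun v => ((ContinuousLinearMap.apply ℂ ℂ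
    ((Pi.single v 1, 0) : Cspace n)).analyticAt _).comp hf.fderiv).prod
    (((ContinuousLinearMap.apply ℂ ℂ ((0, 1) : Cspace n)).analyticAt _).comp hf.fderiv)

/-- A continuous function that vanishes near `t` off the coordinate hyperplanes vanishes at `t`. -/
theorem eq_zero_of_eventually_eq_zero_off_coordinates {n : ℕ} {L : (Fin n → ℂ) → ℂ} {t : Fin n → ℂ}
    (hL : ContinuousAt L t) (h : ∀ᶠ s in 𝓝 t, (∀ v, s v ≠ 0) → L s = 0) : L t = 0 := by
  by_contra hne
  have hdense : Dense (Set.univ.pi fun _ : Fin n => ({0}ᶜ : Set ℂ)) :=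
    dense_pi _ fun _ _ => dense_compl_singleton 0
  obtain ⟨s, hs, hs'⟩ := ((mem_closure_iff_frequently.1 (hdense t)).and_eventually
    ((hL.eventually_ne hne).and h)).exists
  exact hs'.1 (hs'.2 fun v => hs v (Set.mem_univ v))

/-- If `x = t ^ d` is close to the origin, then so is `t`. -/
theorem eventually_forall_root {n : ℕ} {d : Fin n → ℕ}
    {p : (Fin n → ℂ) → Prop} (hp : ∀ᶠ t in 𝓝 0, p t) :
    ∀ᶠ x : Fin n → ℂ in 𝓝 0, ∀ t : Fin n → ℂ, (∀ v, t v ^ d v = x v) → p t := by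
  obtain ⟨ε, hε, hball⟩ := Metric.eventually_nhds_iff.1 hp
  have h1 : ∀ᶠ x : Fin n → ℂ in 𝓝 0, ∀ v, ‖x v‖ < ε ^ d v := eventually_all.2 fun v => by
    have h2 : ContinuousAt (fun x : Fin n → ℂ => ‖x v‖) 0 :=
      (continuous_apply v).norm.continuousAt
    exact h2.eventually_lt_const (by simpa using pow_pos hε (d v))
  filter_upwards [h1] with x hx t ht
  refine hball ?_
  rw [dist_zero_right, pi_norm_lt_iff hε]
  intro v
  have h3 := hx v
  rw [← ht v, norm_pow] at h3
  exact lt_of_pow_lt_pow_left₀ _ hε.le h3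

/-- Along the parametrization the gradient `(ξ, η)` of `f` satisfies
`∏ (ξ_v + η α_v) ^ e_v = η ^ E ψ`. -/
theorem gradientVec_equation {n m : ℕ} {f : Cspace n → ℂ} {N : Fin (m + 1) → Fin n → ℚ≥0}
    (hf : AnalyticAt ℂ f 0) (h0 : N 0 = 0) (hN : StrictMono N) {G : Fin m → (Fin n → ℂ) → ℂ}
    (hG : ∀ i, AnalyticAt ℂ (G i) 0)
    (hpar : ∀ᶠ t in 𝓝 (0 : Fin n → ℂ),
      f (fun v => t v ^ ramIndex N (Fin.last m) v, ramifiedSum N G t) = 0)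
    (i : Fin m) (I : Finset (Fin n)) (hI : ∀ v ∈ I, ∀ j < i, N j.succ v = 0)
    (hS : 1 ≤ ∑ v ∈ I, N i.succ v)
    (hw : ∃ w, N i.succ w ≠ 0 ∧ (w ∉ I ∨ 1 < ∑ v ∈ I, N i.succ v)) :
    ∃ (e : Fin n → ℕ) (α : Fin n → (Fin n → ℂ) → ℂ) (ψ : (Fin n → ℂ) → ℂ),
      (∀ v, AnalyticAt ℂ (α v) 0) ∧ (∀ v, α v 0 = 0) ∧ AnalyticAt ℂ ψ 0 ∧ ψ 0 = 0 ∧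
      ∀ᶠ t in 𝓝 (0 : Fin n → ℂ),
        ∏ v ∈ I,
          ((gradientVec f (fun v => t v ^ ramIndex N (Fin.last m) v, ramifiedSum N G t)).1 v +
          (gradientVec f (fun v => t v ^ ramIndex N (Fin.last m) v, ramifiedSum N G t)).2 *
            α v t) ^ e v =
        (gradientVec f (fun v => t v ^ ramIndex N (Fin.last m) v, ramifiedSum N G t)).2 ^
          (∑ v ∈ I, e v) * ψ t := by
  classical
  let d := ramIndex N (Fin.last m)
  have hd : ∀ v, d v ≠ 0 := ramIndex_ne_zero N _
  let φ := ramifiedSum N G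
  have hφ : AnalyticAt ℂ φ 0 := analyticAt_ramifiedSum N hG
  let q : (Fin n → ℂ) → Cspace n := fun t => (fun v => t v ^ d v, φ t)
  have hq0 : q 0 = 0 := Prod.ext (by ext v; simp [q, hd v]) (ramifiedSum_zero h0 hN G)
  have hq : AnalyticAt ℂ q 0 := (analyticAt_powers d 0).prod hφ
  obtain ⟨e, Q, ⟨w, hQw⟩, hQ⟩ := exists_balanced_powers (N i.succ) d (liftedExponent N i.succ) I hd
    (liftedExponent_eq N i.succ) hS hw
  have hαβ : ∀ v, ∃ α β : (Fin n → ℂ) → ℂ, AnalyticAt ℂ α 0 ∧ AnalyticAt ℂ β 0 ∧ α 0 = 0 ∧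
      (v ∈ I → ∀ᶠ t in 𝓝 (0 : Fin n → ℂ), t v * fderiv ℂ φ t (Pi.single v 1) =
        (d v : ℂ) * t v ^ d v * α t + (∏ w, t w ^ liftedExponent N i.succ w) * β t) := fun v => by
    by_cases hv : v ∈ I
    · obtain ⟨α, β, h1, h2, h3, h4⟩ := exists_logDeriv_ramifiedSum h0 hN hG i v (hI v hv)
      exact ⟨α, β, h1, h2, h3, fun _ => h4⟩
    · exact ⟨0, 0, analyticAt_const, analyticAt_const, rfl, fun h => absurd h hv⟩
  choose α β hα hβ hα0 hlog using hαβ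
  let ψ : (Fin n → ℂ) → ℂ := fun t =>
    (-1) ^ (∑ v ∈ I, e v) * (∏ w, t w ^ Q w) * ∏ v ∈ I, ((d v : ℂ)⁻¹ * β v t) ^ e v
  have hψ : AnalyticAt ℂ ψ 0 := (analyticAt_const.mul (analyticAt_monomial Q 0)).mul
    (Finset.analyticAt_fun_prod _ fun v _ => (analyticAt_const.mul (hβ v)).pow _)
  refine ⟨e, α, ψ, hα, hα0, hψ, ?_, ?_⟩
  · have : ∏ w, (0 : Fin n → ℂ) w ^ Q w = 0 :=
      Finset.prod_eq_zero (Finset.mem_univ w) (by simp [hQw])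
    simp only [ψ, this, mul_zero, zero_mul]
  let L : (Fin n → ℂ) → ℂ := fun t => ∏ v ∈ I, ((gradientVec f (q t)).1 v +
    (gradientVec f (q t)).2 * α v t) ^ e v - (gradientVec f (q t)).2 ^ (∑ v ∈ I, e v) * ψ t
  have hgrad : AnalyticAt ℂ (fun t => gradientVec f (q t)) 0 :=
    AnalyticAt.comp_of_eq hf.gradientVec hq hq0
  have hη : AnalyticAt ℂ (fun t => (gradientVec f (q t)).2) 0 := analyticAt_snd.comp hgrad
  have hξ : ∀ v, AnalyticAt ℂ (fun t => (gradientVec f (q t)).1 v) 0 := fun v =>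
    ((ContinuousLinearMap.proj (R := ℂ) (φ := fun _ : Fin n => ℂ) v).analyticAt _).comp
      (analyticAt_fst.comp hgrad)
  have hL : AnalyticAt ℂ L 0 := (Finset.analyticAt_fun_prod _ fun v _ =>
    ((hξ v).add (hη.mul (hα v))).pow _).sub ((hη.pow _).mul hψ)
  have hfq : ∀ᶠ t in 𝓝 0, AnalyticAt ℂ f (q t) :=
    hq.continuousAt.eventually (by rw [hq0]; exact hf.eventually_analyticAt)
  have hoff : ∀ᶠ t in 𝓝 (0 : Fin n → ℂ), (∀ v, t v ≠ 0) → L t = 0 := by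
    have hlog' : ∀ᶠ t in 𝓝 (0 : Fin n → ℂ), ∀ v ∈ I, t v * fderiv ℂ φ t (Pi.single v 1) =
        (d v : ℂ) * t v ^ d v * α v t + (∏ w, t w ^ liftedExponent N i.succ w) * β v t :=
      (eventually_all_finset _).2 fun v hv => hlog v hv
    filter_upwards [hlog', hfq, hφ.eventually_analyticAt, hpar.eventually_nhds]
      with t hlt hft hφt hpt hne
    set ξ := (gradientVec f (q t)).1 with hξdef
    set η := (gradientVec f (q t)).2 with hηdef
    have hrel : ∀ v ∈ I, ((d v : ℂ) * t v ^ d v) * (ξ v + η * α v t) =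
        -η * ((∏ w, t w ^ liftedExponent N i.succ w) * β v t) := fun v hv => by
      have h1 : d v * t v ^ (d v - 1) * ξ v + η * fderiv ℂ φ t (Pi.single v 1) = 0 :=
        gradientVec_parametrization hφt.differentiableAt hft.differentiableAt hpt v
      have h2 : t v ^ (d v - 1) * t v = t v ^ d v := by
        rw [← pow_succ, Nat.sub_add_cancel (Nat.pos_of_ne_zero (hd v))]
      linear_combination t v * h1 - (d v * ξ v) * h2 - η * hlt v hv
    have hprod : ∏ v ∈ I, (((d v : ℂ) * t v ^ d v) * (ξ v + η * α v t)) ^ e v =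
        ∏ v ∈ I, (-η * ((∏ w, t w ^ liftedExponent N i.succ w) * β v t)) ^ e v :=
      Finset.prod_congr rfl fun v hv => by rw [hrel v hv]
    simp only [mul_pow, Finset.prod_mul_distrib, Finset.prod_pow_eq_pow_sum] at hprod
    -- both sides are now divisible by `∏ x_v ^ e_v`, which is cancelled
    rw [hQ t] at hprod
    have hX : ∏ v ∈ I, (t v ^ d v) ^ e v ≠ 0 :=
      Finset.prod_ne_zero_iff.2 fun v _ => pow_ne_zero _ (pow_ne_zero _ (hne v))
    have hdE : ∏ v ∈ I, (d v : ℂ) ^ e v ≠ 0 :=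
      Finset.prod_ne_zero_iff.2 fun v _ => pow_ne_zero _ (Nat.cast_ne_zero.2 (hd v))
    have hfin : ∏ v ∈ I, (ξ v + η * α v t) ^ e v = η ^ (∑ v ∈ I, e v) * ψ t := by
      refine mul_left_cancel₀ (mul_ne_zero hdE hX) ?_
      rw [hprod]
      simp only [ψ, mul_pow, Finset.prod_mul_distrib, inv_pow, Finset.prod_inv_distrib]
      rw [neg_pow]
      field_simp
    exact sub_eq_zero.2 hfin
  filter_upwards [hL.eventually_analyticAt, hoff.eventually_nhds] with t h1 h2
  exact sub_eq_zero.1 (eq_zero_of_eventually_eq_zero_off_coordinates h1.continuousAt h2)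

/-! ### Limits of tangents -/

/-- A holomorphic function of `(x, ξ, η)` whose zero set is a cone in `(ξ, η)` and contains the
gradients of `f` on `f = 0` bounds the set of limits of tangents. -/
theorem limitsOfTangents_subset_of_equation {n : ℕ} {f : Cspace n → ℂ}
    (H : (Fin n → ℂ) × Cspace n → ℂ)
    (han : ∀ᶠ x in 𝓝 (0 : Fin n → ℂ), ∀ z, AnalyticAt ℂ H (x, z))
    (hcone : ∀ᶠ x in 𝓝 (0 : Fin n → ℂ), ∀ (c : ℂˣ) z, H (x, c • z) = 0 ↔ H (x, z) = 0)
    (hgrad : ∀ᶠ q in 𝓝 (0 : Cspace n), f q = 0 → H (q.1, gradientVec f q) = 0) :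
    limitsOfTangents f ⊆ {p | H (0, p.rep) = 0} := by
  intro p hp
  have hfst : Tendsto (Prod.fst : Cspace n → Fin n → ℂ) (𝓝 0) (𝓝 0) :=
    continuous_fst.tendsto (0 : Cspace n)
  obtain ⟨U, hU, hUo, hU0⟩ := mem_nhds_iff.1 (inter_mem
    ((hfst.eventually han).and (hfst.eventually hcone)) hgrad)
  have hrep : ∀ q ∈ U, ∀ z (hz : z ≠ 0),
      H (q.1, (Projectivization.mk ℂ z hz).rep) = 0 ↔ H (q.1, z) = 0 := fun q hq z hz => by
    obtain ⟨c, hc⟩ := Projectivization.exists_smul_eq_mk_rep ℂ z hz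
    rw [← hc]
    exact (hU hq).1.2 c z
  refine (hp U hUo hU0 {z | z.1 ∈ U ∧ H (z.1.1, z.2.rep) = 0} ⟨⟨?_, ?_, ?_⟩, ?_⟩).2
  · exact fun z hz => ⟨hz.1, Set.mem_univ _⟩
  · rintro z ⟨hz, hzA⟩
    exact ⟨hzA.1, hz⟩
  · rintro z ⟨hzU, hz0⟩
    refine ⟨1, fun _ z => H (z.1.1, z.2), fun _ => ?_, ?_⟩
    · exact ((hU hzU).1.1 z.2).comp_of_eq
        ((analyticAt_fst.comp analyticAt_fst).prod analyticAt_snd) rfl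
    · have hopen : IsOpen (U ×ˢ ({0}ᶜ : Set (Cspace n))) := hUo.prod isOpen_compl_singleton
      filter_upwards [hopen.mem_nhds ⟨hzU, hz0⟩] with y hy
      constructor
      · rintro ⟨hy0, hyA⟩ _
        exact (hrep _ hy.1 _ hy0).1 hyA.2
      · exact fun h => ⟨hy.2, hy.1, (hrep _ hy.1 _ hy.2).2 (h 0)⟩
  · rintro z ⟨⟨hz0, hz, hz2⟩, hzU, -⟩
    refine ⟨hzU, ?_⟩
    rw [hz2]
    exact (hrep z.1 hzU _ hz).2 ((hU hzU).2 hz0)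

theorem mainTheorem8 {n m : ℕ} (f : Cspace n → ℂ) (N : Fin (m + 1) → Fin n → ℚ≥0)
    (hirr : IsIrreducibleGerm f) (hqo : IsQuasiOrdinary f) (hN : HasSpecialMonomials f N)
    (k : ℕ) (hk1 : 1 ≤ k) (hkg : k ≤ numVerySpecial N)
    (I : Finset (Fin n)) (hI : I ⊆ newVariables N k)
    (h : (1 < ∑ v ∈ I, verySpecialMonomial N k v) ∨
      (k = 1 ∧ ∑ v ∈ I, verySpecialMonomial N 1 v = 1 ∧
        1 < ∑ v ∈ newVariables N 1, verySpecialMonomial N 1 v) ∨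
      (2 ≤ k ∧ ∑ v ∈ I, verySpecialMonomial N k v = 1)) :
    limitsOfTangents f ⊆ {p : Pspace n | ∏ v ∈ I, p.rep.1 v = 0} := by
  classical
  obtain ⟨h0, hmono, G, hG, hpar⟩ := hN
  have hG' : ∀ i, AnalyticAt ℂ (G i) 0 := fun i => (hG i).1
  obtain ⟨i, hi, hnew, hold⟩ := exists_index_verySpecialMonomial h0 hmono hk1 hkg
  have hS : 1 ≤ ∑ v ∈ I, N i.succ v := by
    rw [← hi]
    rcases h with h | ⟨rfl, h, -⟩ | ⟨-, h⟩
    · exact h.le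
    · exact h.ge
    · exact h.ge
  have hw : ∃ w, N i.succ w ≠ 0 ∧ (w ∉ I ∨ 1 < ∑ v ∈ I, N i.succ v) := by
    rw [← hi]
    rcases h with h | ⟨rfl, h, h'⟩ | ⟨hk2, -⟩
    · obtain ⟨w, -, hw⟩ := Finset.exists_ne_zero_of_sum_ne_zero (zero_lt_one.trans h).ne'
      exact ⟨w, hw, Or.inr h⟩
    · obtain ⟨w, hw, hwI⟩ : ∃ w ∈ newVariables N 1, w ∉ I := by
        by_contra hcon
        push Not at hcon
        rw [Finset.Subset.antisymm hI hcon] at h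
        exact h'.ne' h
      exact ⟨w, (Finset.mem_filter.1 hw).2.1, Or.inl hwI⟩
    · obtain ⟨w, hw, hw0⟩ := hold hk2
      exact ⟨w, hw0, Or.inl fun hwI => hw (hI hwI)⟩
  let d := ramIndex N (Fin.last m)
  have hd : ∀ v, d v ≠ 0 := ramIndex_ne_zero N _
  have : ∀ v, NeZero (d v) := fun v => ⟨hd v⟩
  have hpar' : ∀ᶠ t in 𝓝 (0 : Fin n → ℂ), f (fun v => t v ^ d v, ramifiedSum N G t) = 0 := by
    have hq : ContinuousAt (fun t : Fin n → ℂ =>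
        ((fun v => t v ^ d v, ramifiedSum N G t) : Cspace n)) 0 :=
      ((analyticAt_powers d 0).prod (analyticAt_ramifiedSum N hG')).continuousAt
    have hq0 : ((fun v => (0 : Fin n → ℂ) v ^ d v, ramifiedSum N G 0) : Cspace n) = 0 :=
      Prod.ext (by ext v; simp [hd v]) (ramifiedSum_zero h0 hmono G)
    rw [ContinuousAt, hq0] at hq
    filter_upwards [hq.eventually hpar] with t ht
    exact ht.2 ⟨t, fun v => rfl, rfl⟩
  obtain ⟨e, α, ψ, hα, hα0, hψ, hψ0, heq⟩ :=
    gradientVec_equation hirr.1 h0 hmono hG' hpar' i I (fun v hv => hnew v (hI hv)) hS hw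
  obtain ⟨H, hHan, hH⟩ := exists_covector_equation d I e (∑ v ∈ I, e v) α ψ hα hψ
  have hH0 : ∀ z : Cspace n, H (0, z) = 0 → ∏ v ∈ I, z.1 v = 0 := fun z hz => by
    have h1 := hH.self_of_nhds z
    have h2 : (fun v => (0 : Fin n → ℂ) v ^ d v) = 0 := by
      ext v
      simp [hd v]
    rw [h2, hz] at h1
    obtain ⟨ζ, -, hζ⟩ := Finset.prod_eq_zero_iff.1 h1.symm
    simp only [deckMul_zero, hα0, hψ0, mul_zero, add_zero, sub_zero] at hζ
    obtain ⟨v, hv, hv0⟩ := Finset.prod_eq_zero_iff.1 hζ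
    exact Finset.prod_eq_zero hv (eq_zero_of_pow_eq_zero hv0)
  refine (limitsOfTangents_subset_of_equation H hHan ?_ ?_).trans fun p hp => hH0 _ hp
  · filter_upwards [eventually_forall_root hH] with x hx c z
    -- homogeneity is visible on the product formula, at any `t` above `x`
    choose t ht using fun v => IsAlgClosed.exists_pow_nat_eq (x v) (Nat.pos_of_ne_zero (hd v))
    have hxt := hx t ht
    rw [show (fun v => t v ^ d v) = x from funext ht] at hxt
    rw [hxt, hxt, Finset.prod_eq_zero_iff, Finset.prod_eq_zero_iff]
    refine exists_congr fun ζ => and_congr_right fun _ => ?_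
    have h1 : ∏ v ∈ I, ((c • z).1 v + (c • z).2 * α v (deckMul ζ t)) ^ e v -
        (c • z).2 ^ (∑ v ∈ I, e v) * ψ (deckMul ζ t) =
        (c : ℂ) ^ (∑ v ∈ I, e v) * (∏ v ∈ I, (z.1 v + z.2 * α v (deckMul ζ t)) ^ e v -
          z.2 ^ (∑ v ∈ I, e v) * ψ (deckMul ζ t)) := by
      rw [mul_sub, ← Finset.prod_pow_eq_pow_sum I e (c : ℂ), ← Finset.prod_mul_distrib,
        Finset.prod_pow_eq_pow_sum]
      simp only [Prod.smul_fst, Prod.smul_snd, Pi.smul_apply, Units.smul_def, smul_eq_mul, mul_pow,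
        ← mul_add, mul_assoc]
    rw [h1, mul_eq_zero, or_iff_right (pow_ne_zero _ c.ne_zero)]
  · have hfst : Tendsto (Prod.fst : Cspace n → Fin n → ℂ) (𝓝 0) (𝓝 0) :=
      continuous_fst.tendsto (0 : Cspace n)
    filter_upwards [hpar, hfst.eventually (eventually_forall_root (hH.and heq))]
      with q hq hroot hq0
    obtain ⟨t, ht, hqt⟩ := hq.1 hq0
    obtain ⟨h1, h2⟩ := hroot t ht
    have hqe : q = (fun v => t v ^ d v, ramifiedSum N G t) :=
      Prod.ext (funext fun v => (ht v).symm) hqt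
    have hone : deckMul (1 : DeckGroup d) t = t := by
      ext v
      simp [deckMul]
    rw [hqe]
    simp only
    rw [h1]
    -- the factor of the norm at the trivial deck transformation vanishes
    refine Finset.prod_eq_zero (Finset.mem_univ 1) ?_
    rw [hone]
    exact sub_eq_zero.2 h2
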